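/- **Proposition 3.2.** Let $n\ge 2$, let $\Omega\subset\mathbb{R}^n$ be a domain, and let $f\in C^\infty(\Omega)$ be strictly convex, i.e. with positive definite Hessian $(f_{ij})$. Let $M^n=\{(x,f(x)) : x\in\Omega\}$ be the corresponding Calabi hypersurface, with Calabi metric $G=\sum f_{ij}\,dx_i\,dx_j$ and Fubini–Pick tensor $A_{ij}^k=-\tfrac12\sum_l f^{kl}f_{ijl}$, where $(f^{kl})=(f_{ij})^{-1}$; write $A_uv$ for the vector with components $\sum_{i,j} A_{ij}^k u^iv^j$. For $p\in M^n$ put $$\theta(p)=\max\{G(A_uu,u) : u\in T_pM^n,\ G(u,u)=1\}.$$ Let $\lambda_1:M^n\to\mathbb{R}$ be a function and put $\mu=\lambda_1/2$. Then the following are equivalent. 1. Around every point of $M^n$ there is a smooth local $G$-orthonormal frame $\{E_1,\dots,E_n\}$ which is an Ejiri frame, i.e. at every point $q$ of its domain the unit vector $E_1(q)$ attains the maximum $\theta(q)$ of $G(A_uu,u)$ over the unit vectors $u\in T_qM^n$, and which satisfies $$A_{E_1}E_1=\lambda_1E_1,\qquad A_{E_1}E_i=\mu E_i\quad(2\le i\le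 n),\qquad \mu=\tfrac{\lambda_1}{2}>0.$$ 2. $\lambda_1$ is a positive constant, $\theta\equiv\lambda_1$ on $M^n$, and $(M^n,G)$ has constant sectional curvature $-\mu^2$. -/

import Mathlib

open scoped ContDiff

noncomputable section

namespace CalabiGeometry

/-! Points of the base domain and tangent vectors are written in the affine coordinates
`x₁, …, xₙ`, as elements of `Fin n → ℝ`. The norm of that space plays no role; lengths and
angles are always measured with a metric `g`, a field of symmetric matrices. -/

variable {n : ℕ}

/-- The partial derivative `∂h/∂xᵢ`. -/
def pd (i : Fin n) (h : (Fin n → ℝ) → ℝ) (x : Fin n → ℝ) : ℝ :=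
  fderiv ℝ h x (Pi.single i 1)

/-- The inner product `g(u, v) = ∑ gᵢⱼ uⁱ vʲ` of two tangent vectors at `x`. -/
def metricInner (g : (Fin n → ℝ) → Matrix (Fin n) (Fin n) ℝ) (x u v : Fin n → ℝ) : ℝ :=
  ∑ i, ∑ j, g x i j * u i * v j

/-- The Christoffel symbols `Γᵏᵢⱼ = ½ ∑ₗ gᵏˡ (∂ᵢ gⱼₗ + ∂ⱼ gᵢₗ - ∂ₗ gᵢⱼ)` of the Levi-Civita
connection of `g`. -/
def christoffel (g : (Fin n → ℝ) → Matrix (Fin n) (Fin n) ℝ) (k i j : Fin n)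
    (x : Fin n → ℝ) : ℝ :=
  (1 / 2) * ∑ l, (g x)⁻¹ k l *
    (pd i (fun y => g y j l) x + pd j (fun y => g y i l) x - pd l (fun y => g y i j) x)

/-- The components `Rˡᵢⱼₖ` of the Riemann curvature tensor, with
`R(∂ᵢ, ∂ⱼ)∂ₖ = ∇ᵢ∇ⱼ∂ₖ - ∇ⱼ∇ᵢ∂ₖ = ∑ₗ Rˡᵢⱼₖ ∂ₗ`. -/
def riemann (g : (Fin n → ℝ) → Matrix (Fin n) (Fin n) ℝ) (l i j k : Fin n)
    (x : Fin n → ℝ) : ℝ :=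
  pd i (christoffel g l j k) x - pd j (christoffel g l i k) x +
    ∑ m, (christoffel g l i m x * christoffel g m j k x -
      christoffel g l j m x * christoffel g m i k x)

/-- The vector `R(u, v)w`. -/
def curvature (g : (Fin n → ℝ) → Matrix (Fin n) (Fin n) ℝ) (x u v w : Fin n → ℝ) :
    Fin n → ℝ :=
  fun l => ∑ i, ∑ j, ∑ k, riemann g l i j k x * u i * v j * w k

/-- The sectional curvature of the plane spanned by `u` and `v`
(meaningful when `u`, `v` are linearly independent). -/
def sectionalCurvature (g : (Fin n → ℝ) → Matrix (Fin n) (Fin n) ℝ) (x u v : Fin n → ℝ) : ℝ :=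
  metricInner g x (curvature g x u v v) u /
    (metricInner g x u u * metricInner g x v v - metricInner g x u v ^ 2)

/-- All tangent planes at all points of `Ω` have sectional curvature `κ`. -/
def HasConstantSectionalCurvature (g : (Fin n → ℝ) → Matrix (Fin n) (Fin n) ℝ)
    (Ω : Set (Fin n → ℝ)) (κ : ℝ) : Prop :=
  ∀ x ∈ Ω, ∀ u v : Fin n → ℝ, LinearIndependent ℝ ![u, v] → sectionalCurvature g x u v = κ

/-- The Calabi metric `G = ∑ fᵢⱼ dxᵢ dxⱼ` of the graph of `f`. -/
def calabiMetric (f : (Fin n → ℝ) → ℝ) (x : Fin n → ℝ) : Matrix (Fin n) (Fin n) ℝ :=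
  Matrix.of fun i j => pd i (pd j f) x

/-- The graph `{(x, f x) | x ∈ Ω}` is a Calabi hypersurface: `Ω` is a domain and `f` is a smooth
function on `Ω` that is strictly convex, in the sense that its Hessian, the Calabi metric, is
positive definite. -/
structure IsCalabiHypersurface (Ω : Set (Fin n → ℝ)) (f : (Fin n → ℝ) → ℝ) : Prop where
  isOpen : IsOpen Ω
  isConnected : IsConnected Ω
  smooth : ContDiffOn ℝ ∞ f Ω
  posDef : ∀ x ∈ Ω, (calabiMetric f x).PosDef

/-- The vector `A_u v` for the Fubini-Pick tensor `Aᵏᵢⱼ = -½ ∑ₗ fᵏˡ fᵢⱼₗ`, where `(fᵏˡ)` is the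
inverse of the Hessian `(fᵢⱼ)`. -/
def fubiniPick (f : (Fin n → ℝ) → ℝ) (x u v : Fin n → ℝ) : Fin n → ℝ :=
  fun k => ∑ i, ∑ j,
    (-(1 / 2) * ∑ l, (calabiMetric f x)⁻¹ k l * pd i (pd j (pd l f)) x) * u i * v j

/-- The cubic form `F(u) = G(A_u u, u)`. -/
def pickForm (f : (Fin n → ℝ) → ℝ) (x u : Fin n → ℝ) : ℝ :=
  metricInner (calabiMetric f) x (fubiniPick f x u u) u

/-- `θ(x)`, the maximum of `G(A_u u, u)` over the unit vectors `u` at `x`. The unit sphere of a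
positive definite metric is compact, so this supremum is a maximum. -/
def theta (f : (Fin n → ℝ) → ℝ) (x : Fin n → ℝ) : ℝ :=
  sSup {r : ℝ | ∃ u, metricInner (calabiMetric f) x u u = 1 ∧ r = pickForm f x u}

/-- `E₀, …, Eₙ₋₁` is a smooth `G`-orthonormal frame on `U` whose first member attains, at every
point, the maximum of `u ↦ G(A_u u, u)` over the unit vectors. -/
structure IsEjiriFrame [NeZero n] (f : (Fin n → ℝ) → ℝ) (U : Set (Fin n → ℝ))
    (E : Fin n → (Fin n → ℝ) → (Fin n → ℝ)) : Prop where
  smooth : ∀ i, ContDiffOn ℝ ∞ (E i) U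
  orthonormal : ∀ x ∈ U, ∀ i j,
    metricInner (calabiMetric f) x (E i x) (E j x) = if i = j then 1 else 0
  isMax : ∀ x ∈ U, ∀ u, metricInner (calabiMetric f) x u u = 1 →
    pickForm f x u ≤ pickForm f x (E 0 x)

/-- Around every point of `Ω` there is an Ejiri frame such that, with `μ = λ₁ / 2 > 0`, the first
member `E₀` satisfies `A_{E₀} E₀ = λ₁ E₀` and `A_{E₀} Eᵢ = μ Eᵢ` for all other `i`.
Here `λ₁` is a function on `Ω`, which is not assumed to be constant. -/
def HasSpecialEjiriFrame [NeZero n] (f : (Fin n → ℝ) → ℝ) (Ω : Set (Fin n → ℝ))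
    (lam : (Fin n → ℝ) → ℝ) : Prop :=
  ∀ p ∈ Ω, ∃ U : Set (Fin n → ℝ), IsOpen U ∧ p ∈ U ∧ U ⊆ Ω ∧
    ∃ E : Fin n → (Fin n → ℝ) → (Fin n → ℝ), IsEjiriFrame f U E ∧
      ∀ x ∈ U, 0 < lam x / 2 ∧
        fubiniPick f x (E 0 x) (E 0 x) = lam x • E 0 x ∧
        ∀ i, i ≠ 0 → fubiniPick f x (E 0 x) (E i x) = (lam x / 2) • E i x

end CalabiGeometry

end

/-!
Write `⟨·, ·⟩` for the Calabi metric `G`. The trilinear form `⟨A_u v, w⟩ = -½ ∑ fᵢⱼₖ uⁱ vʲ wᵏ` is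
totally symmetric, the Christoffel symbols of `G` are the components of `-A`, and, because the
fourth derivatives of `f` are symmetric, the Gauss equation `⟨R(u, v)v, u⟩ = |A_u v|² - ⟨A_u u, A_v v⟩`
holds (`IsCalabiHypersurface.inner_curvature`).

Everything rests on a normal form at a point (`IsPickAlgebra.apply_eq`). Let `e` be a unit vector
that maximizes the cubic form `F(u) = ⟨A_u u, u⟩`, with `A_e e = 2 μ e` and `A_e = μ` on `e^⊥`. For
`X ⊥ e` one has `F(e + t X) = 2 μ + 3 μ t² |X|² + t³ F(X)`, while maximality bounds this by
`2 μ (1 + t² |X|²)^{3/2} = 2 μ + 3 μ t² |X|² + O(t⁴)`. Hence `F` vanishes on `e^⊥`, and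
`A_u v = μ (⟨e, u⟩ v + ⟨e, v⟩ u + (⟨u, v⟩ - ⟨e, u⟩⟨e, v⟩) e)`. Substituted in the Gauss equation
this gives sectional curvature `-μ²`.

Given a special Ejiri frame, the normal form holds at all points. Differentiating
`∑ fᵢⱼₖ eᵏ = -2 μ (gᵢⱼ + eᵢ eⱼ)` in a further direction and using the symmetry of the fourth
derivatives (the Codazzi equation) gives `dμ = 0` (`IsNormalForm.fderiv_eq_zero`), so `μ` is
constant on the connected set `Ω`.

Conversely, let `e` attain the maximum `θ = 2 μ` at a point. The first-order condition is
`A_e e = 2 μ e`, and the curvature of the planes containing `e` says that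
`|A_e X - μ X|² = 0` for `X ⊥ e`, so that the normal form holds again. Its trace is
`(n + 1) μ e` (`IsCalabiHypersurface.trace_fubiniPick`), which shows that `e` is a smooth vector
field; Gram-Schmidt completes it to a local frame.
-/

noncomputable section

namespace CalabiGeometry

/-! ### Pointwise algebra of the Fubini-Pick tensor -/

section Algebra

variable {V : Type*} [AddCommGroup V] [Module ℝ V]

/-- The pointwise algebra of a Fubini-Pick tensor: `B` is a Euclidean inner product on the tangent
space, `A u v` stands for `A_u v`, and the trilinear form `B (A u v) w` is totally symmetric. -/
structure IsPickAlgebra (B : V →ₗ[ℝ] V →ₗ[ℝ] ℝ) (A : V →ₗ[ℝ] V →ₗ[ℝ] V) : Prop where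
  symm : ∀ u v, B u v = B v u
  pos : ∀ u, u ≠ 0 → 0 < B u u
  comm : ∀ u v, A u v = A v u
  selfAdjoint : ∀ u v w, B (A u v) w = B v (A u w)

namespace IsPickAlgebra

variable {B : V →ₗ[ℝ] V →ₗ[ℝ] ℝ} {A : V →ₗ[ℝ] V →ₗ[ℝ] V} {e : V} {θ μ : ℝ}

theorem nonneg (h : IsPickAlgebra B A) (u : V) : 0 ≤ B u u := by
  by_cases hu : u = 0
  · simp [hu]
  · exact (h.pos u hu).le

theorem eq_zero (h : IsPickAlgebra B A) {u : V} (hu : B u u = 0) : u = 0 := by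
  by_contra hne
  exact (h.pos u hne).ne' hu

theorem eq_of_forall (h : IsPickAlgebra B A) {u v : V} (huv : ∀ w, B u w = B v w) : u = v := by
  rw [← sub_eq_zero]
  apply h.eq_zero
  simp [huv]

/-- Vectors are determined by their products with a unit vector `e` and with the vectors
orthogonal to it. -/
theorem eq_of_forall_orthogonal (h : IsPickAlgebra B A) (he : B e e = 1) {u v : V}
    (hu : B u e = B v e) (huX : ∀ X, B e X = 0 → B u X = B v X) : u = v := by
  refine h.eq_of_forall fun w => ?_
  have hw : B e (w - B e w • e) = 0 := by simp [he]
  have := huX _ hw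
  simp only [map_sub, map_smul, hu, smul_eq_mul] at this
  linarith

/-- The strict Cauchy-Schwarz inequality. -/
theorem gram_pos (h : IsPickAlgebra B A) {u v : V} (huv : LinearIndependent ℝ ![u, v]) :
    0 < B u u * B v v - B u v ^ 2 := by
  have hv : v ≠ 0 := huv.ne_zero 1
  have hV := h.pos v hv
  have hw : B v v • u - B u v • v ≠ 0 := by
    intro h0
    have := (LinearIndependent.pair_iff.1 huv (B v v) (-B u v)
      (by rw [neg_smul, ← sub_eq_add_neg]; exact h0)).1
    exact hV.ne' this
  have := h.pos _ hw
  simp only [map_sub, map_smul, LinearMap.sub_apply, LinearMap.smul_apply, smul_eq_mul,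
    h.symm v u] at this
  have h2 : 0 < B v v * (B u u * B v v - B u v ^ 2) := by linarith
  exact pos_of_mul_pos_right h2 hV.le

/-- The bound `F(w) ≤ θ |w|³` at `w = e + t X` with `X ⊥ e`, where `|w|` is estimated by
`√(1 + s) ≤ 1 + s / 2`, so that both sides are polynomials in `t`. -/
theorem cubic_le (h : IsPickAlgebra B A) (hθ : 0 ≤ θ)
    (hmax : ∀ u, B u u = 1 → B (A u u) u ≤ θ) (he : B e e = 1) {X : V} (hX : B e X = 0) (t : ℝ) :
    B (A e e) e + 3 * t * B (A e e) X + 3 * t ^ 2 * B (A e X) X + t ^ 3 * B (A X X) X ≤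
      θ * ((1 + t ^ 2 * B X X) * (1 + t ^ 2 * B X X / 2)) := by
  set s := t ^ 2 * B X X with hs
  have hs0 : 0 ≤ s := mul_nonneg (sq_nonneg t) (h.nonneg X)
  set w := e + t • X with hw
  have hww : B w w = 1 + s := by
    simp only [hw, map_add, map_smul, LinearMap.add_apply, LinearMap.smul_apply, smul_eq_mul, he,
      hX, h.symm X e, hs]
    ring
  have hF : B (A w w) w = B (A e e) e + 3 * t * B (A e e) X + 3 * t ^ 2 * B (A e X) X
      + t ^ 3 * B (A X X) X := by
    have h1 : B (A e X) e = B (A e e) X := by rw [h.selfAdjoint, h.symm]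
    have h2 : B (A X X) e = B (A e X) X := by rw [h.selfAdjoint, h.comm X e, h.symm]
    simp only [hw, map_add, map_smul, LinearMap.add_apply, LinearMap.smul_apply, smul_eq_mul,
      h.comm X e, h1, h2]
    ring
  rw [← hF]
  set r := √(1 + s) with hr
  have hr2 : r ^ 2 = 1 + s := Real.sq_sqrt (by linarith)
  have hr0 : 0 < r := Real.sqrt_pos.2 (by linarith)
  have hr1 : r ≤ 1 + s / 2 := by nlinarith [sq_nonneg (r - 1)]
  have hunit := hmax (r⁻¹ • w) (by
    simp only [map_smul, LinearMap.smul_apply, smul_eq_mul, hww, ← hr2]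
    field_simp)
  simp only [map_smul, LinearMap.smul_apply, smul_eq_mul] at hunit
  have hle : B (A w w) w ≤ θ * r ^ 3 := by
    have := mul_le_mul_of_nonneg_right hunit (pow_pos hr0 3).le
    calc B (A w w) w = r⁻¹ * (r⁻¹ * (r⁻¹ * B (A w w) w)) * r ^ 3 := by field_simp
      _ ≤ θ * r ^ 3 := this
  refine hle.trans (mul_le_mul_of_nonneg_left ?_ hθ)
  rw [← hr2, pow_succ]
  exact mul_le_mul_of_nonneg_left hr1 (sq_nonneg r)

/-- First-order condition: a unit vector maximizing the cubic form is an eigenvector. -/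
theorem apply_self_of_max (h : IsPickAlgebra B A) (hθ : 0 ≤ θ)
    (hmax : ∀ u, B u u = 1 → B (A u u) u ≤ θ) (he : B e e = 1) (heθ : B (A e e) e = θ) :
    A e e = θ • e := by
  refine h.eq_of_forall_orthogonal he (by simp [heθ, he]) fun X hX => ?_
  have hle := h.cubic_le hθ hmax he hX
  simp only [map_smul, LinearMap.smul_apply, smul_eq_mul, hX, mul_zero]
  set b := B (A e e) X
  set c := B (A e X) X
  set d := B (A X X) X
  set q := B X X
  let ψ : ℝ → ℝ := fun t =>
    3 * t * b + 3 * t ^ 2 * c + t ^ 3 * d - θ * (3 / 2 * (t ^ 2 * q) + (t ^ 2 * q) ^ 2 / 2)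
  have hψ : HasDerivAt ψ (3 * b) 0 := by
    have h1 := (hasDerivAt_id (0 : ℝ))
    have := ((((h1.const_mul 3).mul_const b).add (((h1.pow 2).const_mul 3).mul_const c)).add
      ((h1.pow 3).mul_const d)).sub
      (((((h1.pow 2).mul_const q).const_mul (3 / 2)).add
        (((((h1.pow 2).mul_const q)).pow 2).div_const 2)).const_mul θ)
    exact this.congr_deriv (by simp)
  have hloc : IsLocalMax ψ 0 := Filter.Eventually.of_forall fun t => by
    have := hle t
    simp only [ψ]
    rw [heθ] at this
    nlinarith
  have := hloc.hasDerivAt_eq_zero hψ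
  linarith

/-- Since `A_e = μ` on `e^⊥` is exactly half of the top eigenvalue, the second-order condition at
the maximum `e` is an equality, and the third-order term, which is odd, has to vanish. -/
theorem cubic_eq_zero (h : IsPickAlgebra B A) (hμ : 0 ≤ μ)
    (hmax : ∀ u, B u u = 1 → B (A u u) u ≤ 2 * μ) (he : B e e = 1)
    (hee : A e e = (2 * μ) • e) (heX : ∀ X, B e X = 0 → A e X = μ • X)
    {X : V} (hX : B e X = 0) : B (A X X) X = 0 := by
  have key : ∀ X, B e X = 0 → B (A X X) X ≤ 0 := by
    intro X hX
    by_contra! hpos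
    have hle := h.cubic_le (by linarith : 0 ≤ 2 * μ) hmax he hX
    simp only [hee, heX X hX, map_smul, LinearMap.smul_apply, smul_eq_mul, he, hX] at hle
    set ℓ := B (A X X) X
    set q := B X X
    have hK : 0 < μ * q ^ 2 + 1 := by positivity
    have ht : 0 < ℓ / (μ * q ^ 2 + 1) := by positivity
    -- This `t` is small enough for the term of third order to dominate that of fourth order.
    have := hle (ℓ / (μ * q ^ 2 + 1))
    set t := ℓ / (μ * q ^ 2 + 1) with htdef
    have hℓ : ℓ = t * (μ * q ^ 2 + 1) := by rw [htdef]; field_simp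
    have h4 : t ^ 3 * ℓ ≤ μ * q ^ 2 * t ^ 4 := by nlinarith
    rw [hℓ] at h4
    have : 0 < t ^ 4 := by positivity
    nlinarith
  refine le_antisymm (key X hX) ?_
  have := key (-X) (by simp [hX])
  simp only [map_neg, LinearMap.neg_apply, neg_neg] at this
  linarith

/-- Polarization of the vanishing cubic form on `e^⊥`. -/
theorem trilinear_eq_zero (h : IsPickAlgebra B A)
    (h0 : ∀ X, B e X = 0 → B (A X X) X = 0) {X Y Z : V} (hX : B e X = 0) (hY : B e Y = 0)
    (hZ : B e Z = 0) : B (A X Y) Z = 0 := by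
  have h2 : ∀ X Y, B e X = 0 → B e Y = 0 → B (A X X) Y = 0 := by
    intro X Y hX hY
    have e1 := h0 (X + Y) (by simp [hX, hY])
    have e2 := h0 (X - Y) (by simp [hX, hY])
    have e3 := h0 Y hY
    have s1 : B (A X Y) X = B (A X X) Y := by rw [h.selfAdjoint, h.symm]
    have s2 : B (A Y Y) X = B (A X Y) Y := by rw [h.selfAdjoint, h.comm Y X, h.symm]
    simp only [map_add, map_sub, LinearMap.add_apply, LinearMap.sub_apply, h.comm Y X, s1, s2]
      at e1 e2
    linarith
  have e1 := h2 (X + Y) Z (by simp [hX, hY]) hZ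
  have e2 := h2 X Z hX hZ
  have e3 := h2 Y Z hY hZ
  simp only [map_add, LinearMap.add_apply, h.comm Y X] at e1
  linarith

/-- The normal form of the Fubini-Pick tensor: it is determined by `B`, `e` and `μ`. -/
theorem apply_eq (h : IsPickAlgebra B A) (hμ : 0 ≤ μ)
    (hmax : ∀ u, B u u = 1 → B (A u u) u ≤ 2 * μ) (he : B e e = 1)
    (hee : A e e = (2 * μ) • e) (heX : ∀ X, B e X = 0 → A e X = μ • X) (u v : V) :
    A u v = μ • (B e u • v + B e v • u + (B u v - B e u * B e v) • e) := by
  have hperp : ∀ X Y, B e X = 0 → B e Y = 0 → A X Y = (μ * B X Y) • e := by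
    intro X Y hX hY
    refine h.eq_of_forall_orthogonal he ?_ fun Z hZ => ?_
    · rw [h.selfAdjoint, h.comm X e, heX X hX, h.symm Y]
      simp [he]
    · rw [h.trilinear_eq_zero (fun X hX => h.cubic_eq_zero hμ hmax he hee heX hX) hX hY hZ]
      simp [hZ]
  have hu : B e (u - B e u • e) = 0 := by simp [he]
  have hv : B e (v - B e v • e) = 0 := by simp [he]
  have h1 := hperp _ _ hu hv
  have h2 := heX _ hu
  have h3 := heX _ hv
  simp only [map_sub, map_smul, LinearMap.sub_apply, LinearMap.smul_apply, hee, h.comm u e,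
    smul_eq_mul, he, h.symm u e] at h1 h2 h3
  rw [sub_eq_iff_eq_add] at h2 h3
  rw [h2, h3] at h1
  rw [sub_sub, sub_eq_iff_eq_add] at h1
  rw [h1]
  module

/-- The numerator of the sectional curvature for a Fubini-Pick tensor in normal form. -/
theorem curvature_eq (h : IsPickAlgebra B A) (he : B e e = 1)
    (hA : ∀ u v, A u v = μ • (B e u • v + B e v • u + (B u v - B e u * B e v) • e)) (u v : V) :
    B (A u v) (A u v) - B (A u u) (A v v) = -μ ^ 2 * (B u u * B v v - B u v ^ 2) := by
  simp only [hA, map_add, map_smul, LinearMap.add_apply, LinearMap.smul_apply, smul_eq_mul, he,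
    h.symm u e, h.symm v e, h.symm v u]
  ring

/-- If all planes through the maximizing unit vector `e` have curvature `-μ²` and the maximum is
`2 μ`, then `|A_e X - μ X|² = 0` for `X ⊥ e`. -/
theorem apply_of_curvature (h : IsPickAlgebra B A) (he : B e e = 1)
    (hee : A e e = (2 * μ) • e)
    (hK : ∀ u v, LinearIndependent ℝ ![u, v] →
      B (A u v) (A u v) - B (A u u) (A v v) = -μ ^ 2 * (B u u * B v v - B u v ^ 2))
    {X : V} (hX : B e X = 0) : A e X = μ • X := by
  by_cases hX0 : X = 0
  · simp [hX0]
  have hli : LinearIndependent ℝ ![e, X] := by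
    rw [LinearIndependent.pair_iff]
    intro s t hst
    have h1 : B e (s • e + t • X) = 0 := by simp [hst]
    have h2 : B X (s • e + t • X) = 0 := by simp [hst]
    simp only [map_add, map_smul, he, hX, h.symm X e, smul_eq_mul] at h1 h2
    have := (h.pos X hX0).ne'
    refine ⟨by linarith, ?_⟩
    have h3 : t * B X X = 0 := by linarith
    simpa [this] using h3
  have hk := hK e X hli
  have hs : B e (A X X) = B (A e X) X := by rw [← h.selfAdjoint, h.comm X e]
  rw [← sub_eq_zero]
  apply h.eq_zero
  simp only [hee, map_sub, map_smul, LinearMap.sub_apply, LinearMap.smul_apply, smul_eq_mul, hs,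
    he, hX, h.symm X (A e X)] at hk ⊢
  linarith

end IsPickAlgebra

end Algebra

variable {n : ℕ}

/-! ### Partial derivatives -/

section PartialDerivatives

variable {Ω : Set (Fin n → ℝ)} {h : (Fin n → ℝ) → ℝ} {x : Fin n → ℝ}

theorem contDiffOn_pd (hΩ : IsOpen Ω) (hh : ContDiffOn ℝ ∞ h Ω) (i : Fin n) :
    ContDiffOn ℝ ∞ (pd i h) Ω :=
  (hh.fderiv_of_isOpen hΩ (by simp)).clm_apply contDiffOn_const

theorem differentiableAt_of_contDiffOn (hΩ : IsOpen Ω) (hh : ContDiffOn ℝ ∞ h Ω) (hx : x ∈ Ω) :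
    DifferentiableAt ℝ h x :=
  (hh.contDiffAt (hΩ.mem_nhds hx)).differentiableAt (by simp)

theorem pd_congr (hΩ : IsOpen Ω) {h' : (Fin n → ℝ) → ℝ} (hh : ∀ y ∈ Ω, h y = h' y) (hx : x ∈ Ω)
    (i : Fin n) : pd i h x = pd i h' x := by
  unfold pd
  rw [Filter.EventuallyEq.fderiv_eq (Filter.eventuallyEq_of_mem (hΩ.mem_nhds hx) hh)]

theorem pd_comm (hΩ : IsOpen Ω) (hh : ContDiffOn ℝ ∞ h Ω) (hx : x ∈ Ω) (i j : Fin n) :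
    pd i (pd j h) x = pd j (pd i h) x := by
  have hc := hh.contDiffAt (hΩ.mem_nhds hx)
  have hd : DifferentiableAt ℝ (fderiv ℝ h) x :=
    ((hh.fderiv_of_isOpen hΩ (m := ∞) (by simp)).contDiffAt (hΩ.mem_nhds hx)).differentiableAt
      (by simp)
  have key : ∀ i j : Fin n, pd i (pd j h) x =
      fderiv ℝ (fderiv ℝ h) x (Pi.single i 1) (Pi.single j 1) := by
    intro i j
    have : HasFDerivAt (pd j h) _ x := hd.hasFDerivAt.clm_apply (hasFDerivAt_const _ x)
    rw [pd, this.fderiv]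
    simp
  rw [key, key]
  exact hc.isSymmSndFDerivAt (by
    simp only [minSmoothness_of_isRCLikeNormedField]
    exact ENat.LEInfty.out) _ _

theorem fderiv_eq_sum_pd (v : Fin n → ℝ) : fderiv ℝ h x v = ∑ i, pd i h x * v i := by
  conv_lhs => rw [← Finset.univ_sum_single v]
  rw [map_sum]
  refine Finset.sum_congr rfl fun i _ => ?_
  have : (Pi.single i (v i) : Fin n → ℝ) = v i • Pi.single i 1 := by
    rw [← Pi.single_smul]; simp
  rw [this, map_smul, smul_eq_mul, mul_comm]
  rfl

theorem hasDerivAt_line (hd : DifferentiableAt ℝ h x) (v : Fin n → ℝ) :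
    HasDerivAt (fun t : ℝ => h (x + t • v)) (∑ i, pd i h x * v i) 0 := by
  rw [← fderiv_eq_sum_pd]
  have hl : HasDerivAt (fun t : ℝ => x + t • v) v 0 := by
    simpa using ((hasDerivAt_id (0 : ℝ)).smul_const v).const_add x
  exact HasFDerivAt.comp_hasDerivAt_of_eq (0 : ℝ) hd.hasFDerivAt hl (by simp)

theorem eventually_line_mem {U : Set (Fin n → ℝ)} (hU : IsOpen U) (hx : x ∈ U) (v : Fin n → ℝ) :
    ∀ᶠ t : ℝ in nhds 0, x + t • v ∈ U := by
  have hc : ContinuousAt (fun t : ℝ => x + t • v) 0 := by fun_prop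
  exact hc.preimage_mem_nhds (hU.mem_nhds (by simpa using hx))

end PartialDerivatives

/-! ### The tensors as multilinear maps -/

section Multilinear

/-- The third derivative of `f`, `∑ fᵢⱼₖ uⁱ vʲ wᵏ`. -/
def third (f : (Fin n → ℝ) → ℝ) (x u v w : Fin n → ℝ) : ℝ :=
  ∑ i, ∑ j, ∑ k, pd i (pd j (pd k f)) x * u i * v j * w k

/-- The fourth derivative of `f`, `∑ fᵢⱼₖₗ uⁱ vʲ wᵏ zˡ`. -/
def fourth (f : (Fin n → ℝ) → ℝ) (x u v w z : Fin n → ℝ) : ℝ :=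
  ∑ i, ∑ j, ∑ k, ∑ l, pd i (pd j (pd k (pd l f))) x * u i * v j * w k * z l

/-- The derivative in the direction `u` of the vector field `-A_v w`, for constant `v`, `w`. -/
def christoffelDeriv (f : (Fin n → ℝ) → ℝ) (x u v w : Fin n → ℝ) : Fin n → ℝ :=
  fun l => ∑ i, ∑ j, ∑ k, pd i (christoffel (calabiMetric f) l j k) x * u i * v j * w k

/-- `metricInner` as a bilinear map. -/
def innerBilin (g : (Fin n → ℝ) → Matrix (Fin n) (Fin n) ℝ) (x : Fin n → ℝ) :
    (Fin n → ℝ) →ₗ[ℝ] (Fin n → ℝ) →ₗ[ℝ] ℝ :=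
  LinearMap.mk₂ ℝ (metricInner g x)
    (by intro u u' v; simp [metricInner, mul_add, add_mul, Finset.sum_add_distrib])
    (by intro c u v
        simp only [metricInner, Finset.mul_sum, smul_eq_mul, Pi.smul_apply]
        exact Finset.sum_congr rfl fun i _ => Finset.sum_congr rfl fun j _ => by ring)
    (by intro u u' v; simp [metricInner, mul_add, Finset.sum_add_distrib])
    (by intro c u v
        simp only [metricInner, Finset.mul_sum, smul_eq_mul, Pi.smul_apply]
        exact Finset.sum_congr rfl fun i _ => Finset.sum_congr rfl fun j _ => by ring)

/-- `fubiniPick` as a bilinear map. -/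
def pickBilin (f : (Fin n → ℝ) → ℝ) (x : Fin n → ℝ) :
    (Fin n → ℝ) →ₗ[ℝ] (Fin n → ℝ) →ₗ[ℝ] (Fin n → ℝ) :=
  LinearMap.mk₂ ℝ (fubiniPick f x)
    (by intro u u' v; ext k
        simp only [fubiniPick, Pi.add_apply, mul_add, add_mul, Finset.sum_add_distrib])
    (by intro c u v; ext k
        simp only [fubiniPick, Finset.mul_sum, smul_eq_mul, Pi.smul_apply]
        exact Finset.sum_congr rfl fun i _ => Finset.sum_congr rfl fun j _ => by
          simp only [Finset.sum_mul, Finset.mul_sum]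
          exact Finset.sum_congr rfl fun l _ => by ring)
    (by intro u u' v; ext k
        simp only [fubiniPick, Pi.add_apply, mul_add, Finset.sum_add_distrib])
    (by intro c u v; ext k
        simp only [fubiniPick, Finset.mul_sum, smul_eq_mul, Pi.smul_apply]
        exact Finset.sum_congr rfl fun i _ => Finset.sum_congr rfl fun j _ => by
          simp only [Finset.sum_mul, Finset.mul_sum]
          exact Finset.sum_congr rfl fun l _ => by ring)

theorem innerBilin_apply (g : (Fin n → ℝ) → Matrix (Fin n) (Fin n) ℝ) (x u v : Fin n → ℝ) :
    innerBilin g x u v = metricInner g x u v := rfl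

theorem pickBilin_apply (f : (Fin n → ℝ) → ℝ) (x u v : Fin n → ℝ) :
    pickBilin f x u v = fubiniPick f x u v := rfl

end Multilinear

/-! ### The third derivative of `f` and the Fubini-Pick tensor -/

namespace IsCalabiHypersurface

variable {Ω : Set (Fin n → ℝ)} {f : (Fin n → ℝ) → ℝ} {x : Fin n → ℝ}

theorem smooth₁ (hf : IsCalabiHypersurface Ω f) (k : Fin n) : ContDiffOn ℝ ∞ (pd k f) Ω :=
  contDiffOn_pd hf.isOpen hf.smooth k

theorem smooth₂ (hf : IsCalabiHypersurface Ω f) (j k : Fin n) :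
    ContDiffOn ℝ ∞ (pd j (pd k f)) Ω :=
  contDiffOn_pd hf.isOpen (hf.smooth₁ k) j

theorem smooth₃ (hf : IsCalabiHypersurface Ω f) (i j k : Fin n) :
    ContDiffOn ℝ ∞ (pd i (pd j (pd k f))) Ω :=
  contDiffOn_pd hf.isOpen (hf.smooth₂ j k) i

theorem pd₃_comm (hf : IsCalabiHypersurface Ω f) (hx : x ∈ Ω) (i j k : Fin n) :
    pd i (pd j (pd k f)) x = pd j (pd i (pd k f)) x :=
  pd_comm hf.isOpen (hf.smooth₁ k) hx i j

theorem pd₃_comm' (hf : IsCalabiHypersurface Ω f) (hx : x ∈ Ω) (i j k : Fin n) :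
    pd i (pd j (pd k f)) x = pd i (pd k (pd j f)) x :=
  pd_congr hf.isOpen (fun _ hy => pd_comm hf.isOpen hf.smooth hy j k) hx i

theorem third_comm (hf : IsCalabiHypersurface Ω f) (hx : x ∈ Ω) (u v w : Fin n → ℝ) :
    third f x u v w = third f x u w v := by
  unfold third
  refine Finset.sum_congr rfl fun i _ => ?_
  rw [Finset.sum_comm]
  refine Finset.sum_congr rfl fun j _ => Finset.sum_congr rfl fun k _ => ?_
  rw [hf.pd₃_comm' hx]
  ring

theorem fourth_comm (hf : IsCalabiHypersurface Ω f) (hx : x ∈ Ω) (u v w z : Fin n → ℝ) :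
    fourth f x u v w z = fourth f x v u w z := by
  unfold fourth
  rw [Finset.sum_comm]
  refine Finset.sum_congr rfl fun j _ => Finset.sum_congr rfl fun i _ =>
    Finset.sum_congr rfl fun k _ => Finset.sum_congr rfl fun l _ => ?_
  rw [pd_comm hf.isOpen (hf.smooth₂ k l) hx]
  ring

theorem metric_symm (hf : IsCalabiHypersurface Ω f) (hx : x ∈ Ω) (i j : Fin n) :
    calabiMetric f x i j = calabiMetric f x j i :=
  pd_comm hf.isOpen hf.smooth hx i j

theorem isUnit_det (hf : IsCalabiHypersurface Ω f) (hx : x ∈ Ω) :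
    IsUnit (calabiMetric f x).det :=
  (hf.posDef x hx).det_pos.ne'.isUnit

theorem inner_fubiniPick (hf : IsCalabiHypersurface Ω f) (hx : x ∈ Ω) (u v w : Fin n → ℝ) :
    metricInner (calabiMetric f) x (fubiniPick f x u v) w = -(1 / 2) * third f x u v w := by
  have hinv : ∀ l m, ∑ k, calabiMetric f x m k * (calabiMetric f x)⁻¹ k l =
      if m = l then 1 else 0 := by
    intro l m
    have := congrFun (congrFun (Matrix.mul_nonsing_inv _ (hf.isUnit_det hx)) m) l
    rwa [Matrix.mul_apply, Matrix.one_apply] at this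
  have h1 : ∀ m, ∑ k, calabiMetric f x k m * fubiniPick f x u v k =
      ∑ i, ∑ j, -(1 / 2) * pd i (pd j (pd m f)) x * u i * v j := by
    intro m
    simp only [fubiniPick, Finset.mul_sum, Finset.sum_mul]
    rw [Finset.sum_comm]
    refine Finset.sum_congr rfl fun i _ => ?_
    rw [Finset.sum_comm]
    refine Finset.sum_congr rfl fun j _ => ?_
    rw [Finset.sum_comm]
    have : ∀ l, ∑ k, calabiMetric f x k m * (-(1 / 2) * ((calabiMetric f x)⁻¹ k l *
        pd i (pd j (pd l f)) x) * u i * v j) =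
        (if m = l then 1 else 0) * (-(1 / 2) * pd i (pd j (pd l f)) x * u i * v j) := by
      intro l
      rw [← hinv, Finset.sum_mul]
      refine Finset.sum_congr rfl fun k _ => ?_
      rw [hf.metric_symm hx k m]
      ring
    simp only [this]
    simp
  calc metricInner (calabiMetric f) x (fubiniPick f x u v) w
      = ∑ m, (∑ k, calabiMetric f x k m * fubiniPick f x u v k) * w m := by
        rw [metricInner, Finset.sum_comm]
        simp only [Finset.sum_mul]
    _ = _ := by
        simp only [h1, third, Finset.mul_sum, Finset.sum_mul]
        rw [Finset.sum_comm]
        refine Finset.sum_congr rfl fun i _ => ?_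
        rw [Finset.sum_comm]
        exact Finset.sum_congr rfl fun j _ => Finset.sum_congr rfl fun k _ => by ring

theorem isPickAlgebra (hf : IsCalabiHypersurface Ω f) (hx : x ∈ Ω) :
    IsPickAlgebra (innerBilin (calabiMetric f) x) (pickBilin f x) := by
  have hs : ∀ u v, metricInner (calabiMetric f) x u v = metricInner (calabiMetric f) x v u := by
    intro u v
    unfold metricInner
    rw [Finset.sum_comm]
    refine Finset.sum_congr rfl fun i _ => Finset.sum_congr rfl fun j _ => ?_
    rw [hf.metric_symm hx]
    ring
  refine ⟨hs, ?_, ?_, ?_⟩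
  · intro u hu
    have := (hf.posDef x hx).dotProduct_mulVec_pos hu
    rw [innerBilin_apply, metricInner]
    simp only [dotProduct, Matrix.mulVec, star_trivial, Finset.mul_sum] at this
    refine this.trans_eq (Finset.sum_congr rfl fun i _ => Finset.sum_congr rfl fun j _ => by ring)
  · intro u v
    ext k
    simp only [pickBilin_apply, fubiniPick]
    rw [Finset.sum_comm]
    refine Finset.sum_congr rfl fun i _ => Finset.sum_congr rfl fun j _ => ?_
    simp only [hf.pd₃_comm hx j i]
    ring
  · intro u v w
    simp only [innerBilin_apply, pickBilin_apply]
    rw [hs v, hf.inner_fubiniPick hx, hf.inner_fubiniPick hx, hf.third_comm hx]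

theorem third_eq (hf : IsCalabiHypersurface Ω f) (hx : x ∈ Ω) (u v w : Fin n → ℝ) :
    third f x u v w = -2 * innerBilin (calabiMetric f) x (pickBilin f x u v) w := by
  rw [innerBilin_apply, pickBilin_apply, hf.inner_fubiniPick hx]
  ring

/-- The derivative along a line of the product of two vector fields. -/
theorem hasDerivAt_inner (hf : IsCalabiHypersurface Ω f) (hx : x ∈ Ω) {v : Fin n → ℝ}
    {a b : ℝ → Fin n → ℝ} {a' b' : Fin n → ℝ} (ha : HasDerivAt a a' 0) (hb : HasDerivAt b b' 0) :
    HasDerivAt (fun t => metricInner (calabiMetric f) (x + t • v) (a t) (b t))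
      (third f x v (a 0) (b 0) + metricInner (calabiMetric f) x a' (b 0) +
        metricInner (calabiMetric f) x (a 0) b') 0 := by
  rw [hasDerivAt_pi] at ha hb
  have := HasDerivAt.fun_sum (u := Finset.univ) fun i _ => HasDerivAt.fun_sum (u := Finset.univ)
    fun j _ => ((hasDerivAt_line
      (differentiableAt_of_contDiffOn hf.isOpen (hf.smooth₂ i j) hx) v).mul
      (ha i)).mul (hb j)
  refine this.congr_deriv ?_
  simp only [zero_smul, add_zero, third, metricInner]
  have h1 : ∑ k, ∑ i, ∑ j, pd k (pd i (pd j f)) x * v k * a 0 i * b 0 j =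
      ∑ i, ∑ j, (∑ k, pd k (pd i (pd j f)) x * v k) * a 0 i * b 0 j := by
    rw [Finset.sum_comm]
    refine Finset.sum_congr rfl fun i _ => ?_
    rw [Finset.sum_comm]
    simp only [Finset.sum_mul]
  rw [h1]
  simp only [← Finset.sum_add_distrib]
  refine Finset.sum_congr rfl fun i _ => Finset.sum_congr rfl fun j _ => ?_
  simp only [calabiMetric, Matrix.of_apply, Pi.mul_apply, zero_smul, add_zero]
  ring

theorem hasDerivAt_third (hf : IsCalabiHypersurface Ω f) (hx : x ∈ Ω) {v : Fin n → ℝ}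
    (w z : Fin n → ℝ) {c : ℝ → Fin n → ℝ} {c' : Fin n → ℝ} (hc : HasDerivAt c c' 0) :
    HasDerivAt (fun t => third f (x + t • v) w z (c t))
      (fourth f x v w z (c 0) + third f x w z c') 0 := by
  rw [hasDerivAt_pi] at hc
  have := HasDerivAt.fun_sum (u := Finset.univ) fun i _ => HasDerivAt.fun_sum (u := Finset.univ)
    fun j _ => HasDerivAt.fun_sum (u := Finset.univ)
    fun k _ => (((hasDerivAt_line (differentiableAt_of_contDiffOn hf.isOpen (hf.smooth₃ i j k) hx)
      v).mul_const (w i)).mul_const (z j)).mul (hc k)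
  refine this.congr_deriv ?_
  simp only [fourth, third]
  have h1 : ∑ l, ∑ i, ∑ j, ∑ k, pd l (pd i (pd j (pd k f))) x * v l * w i * z j * c 0 k =
      ∑ i, ∑ j, ∑ k, (∑ l, pd l (pd i (pd j (pd k f))) x * v l) * w i * z j * c 0 k := by
    rw [Finset.sum_comm]
    refine Finset.sum_congr rfl fun i _ => ?_
    rw [Finset.sum_comm]
    refine Finset.sum_congr rfl fun j _ => ?_
    rw [Finset.sum_comm]
    simp only [Finset.sum_mul]
  rw [h1]
  simp only [← Finset.sum_add_distrib]
  refine Finset.sum_congr rfl fun i _ => Finset.sum_congr rfl fun j _ =>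
    Finset.sum_congr rfl fun k _ => ?_
  simp only [zero_smul, add_zero]

/-! ### The Levi-Civita connection and the Gauss equation -/

/-- The three derivatives of the metric in the Christoffel symbols coincide, so that `Γ = -A`. -/
theorem christoffel_eq (hf : IsCalabiHypersurface Ω f) (hx : x ∈ Ω) (k i j : Fin n) :
    christoffel (calabiMetric f) k i j x =
      1 / 2 * ∑ l, (calabiMetric f x)⁻¹ k l * pd i (pd j (pd l f)) x := by
  unfold christoffel
  congr 1
  refine Finset.sum_congr rfl fun l _ => ?_
  simp only [calabiMetric, Matrix.of_apply]
  rw [hf.pd₃_comm hx j i l, hf.pd₃_comm' hx l i j, hf.pd₃_comm hx l j i, hf.pd₃_comm' hx j l i,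
    hf.pd₃_comm hx j i l]
  ring

/-- Cramer's rule shows that the inverse of the Hessian is smooth. -/
theorem contDiffOn_inv (hf : IsCalabiHypersurface Ω f) (k l : Fin n) :
    ContDiffOn ℝ ∞ (fun y => (calabiMetric f y)⁻¹ k l) Ω := by
  have hdet : ∀ M : (Fin n → ℝ) → Matrix (Fin n) (Fin n) ℝ,
      (∀ i j, ContDiffOn ℝ ∞ (fun y => M y i j) Ω) → ContDiffOn ℝ ∞ (fun y => (M y).det) Ω := by
    intro M hM
    simp only [Matrix.det_apply]
    exact ContDiffOn.sum fun σ _ => (contDiffOn_prod fun i _ => hM _ _).const_smul _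
  have hg : ∀ i j, ContDiffOn ℝ ∞ (fun y => calabiMetric f y i j) Ω := fun i j => hf.smooth₂ i j
  simp only [Matrix.inv_def, Matrix.smul_apply, Ring.inverse_eq_inv', smul_eq_mul,
    Matrix.adjugate_apply]
  refine ((hdet _ hg).inv fun y hy => (hf.isUnit_det hy).ne_zero).mul (hdet _ fun i j => ?_)
  simp only [Matrix.updateRow_apply]
  split_ifs
  · exact contDiffOn_const
  · exact hg i j

theorem contDiffOn_christoffel (hf : IsCalabiHypersurface Ω f) (k i j : Fin n) :
    ContDiffOn ℝ ∞ (christoffel (calabiMetric f) k i j) Ω := by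
  refine ContDiffOn.congr ?_ fun y hy => hf.christoffel_eq hy k i j
  exact contDiffOn_const.mul
    (ContDiffOn.sum fun l _ => (hf.contDiffOn_inv k l).mul (hf.smooth₃ i j l))

theorem sum_christoffel (hf : IsCalabiHypersurface Ω f) (hx : x ∈ Ω) (k : Fin n)
    (u v : Fin n → ℝ) :
    ∑ i, ∑ j, christoffel (calabiMetric f) k i j x * u i * v j = -fubiniPick f x u v k := by
  simp only [fubiniPick, hf.christoffel_eq hx, ← Finset.sum_neg_distrib]
  exact Finset.sum_congr rfl fun i _ => Finset.sum_congr rfl fun j _ => by ring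

theorem hasDerivAt_christoffel (hf : IsCalabiHypersurface Ω f) (hx : x ∈ Ω)
    (u v w : Fin n → ℝ) :
    HasDerivAt (fun t : ℝ => -fubiniPick f (x + t • u) v w) (christoffelDeriv f x u v w) 0 := by
  rw [hasDerivAt_pi]
  intro l
  have := HasDerivAt.fun_sum (u := Finset.univ) fun j _ => HasDerivAt.fun_sum (u := Finset.univ)
    fun k _ => ((hasDerivAt_line (differentiableAt_of_contDiffOn hf.isOpen
      (hf.contDiffOn_christoffel l j k) hx) u).mul_const (v j)).mul_const (w k)
  refine (this.congr_deriv ?_).congr_of_eventuallyEq ?_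
  · symm
    rw [christoffelDeriv, Finset.sum_comm]
    refine Finset.sum_congr rfl fun j _ => ?_
    rw [Finset.sum_comm]
    simp only [Finset.sum_mul]
  · filter_upwards [eventually_line_mem hf.isOpen hx u] with t ht
    exact (hf.sum_christoffel ht l v w).symm

/-- The lowered derivative of the connection, from differentiating `G(-A_v w, z) = ½ f(v, w, z)`. -/
theorem inner_christoffelDeriv (hf : IsCalabiHypersurface Ω f) (hx : x ∈ Ω)
    (u v w z : Fin n → ℝ) :
    metricInner (calabiMetric f) x (christoffelDeriv f x u v w) z =
      1 / 2 * fourth f x u v w z + third f x u (fubiniPick f x v w) z := by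
  have h1 := hf.hasDerivAt_inner hx (v := u) (hf.hasDerivAt_christoffel hx u v w)
    (hasDerivAt_const 0 z)
  have h2 := (hf.hasDerivAt_third hx (v := u) v w (hasDerivAt_const 0 z)).const_mul (1 / 2)
  have h3 := h1.unique (h2.congr_of_eventuallyEq (by
    filter_upwards [eventually_line_mem hf.isOpen hx u] with t ht
    have := hf.inner_fubiniPick ht v w z
    rw [← innerBilin_apply] at this ⊢
    rw [map_neg, LinearMap.neg_apply, this]
    ring))
  simp only [zero_smul, add_zero] at h3
  have e1 : metricInner (calabiMetric f) x (-fubiniPick f x v w) 0 = 0 := by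
    rw [← innerBilin_apply, map_zero]
  have e2 : third f x v w 0 = 0 := by simp [third]
  have e3 : third f x u (-fubiniPick f x v w) z = -third f x u (fubiniPick f x v w) z := by
    simp [third]
  rw [e1, e2, e3] at h3
  linarith

theorem curvature_eq_christoffelDeriv (hf : IsCalabiHypersurface Ω f) (hx : x ∈ Ω)
    (u v w : Fin n → ℝ) :
    curvature (calabiMetric f) x u v w =
      christoffelDeriv f x u v w - christoffelDeriv f x v u w +
        (fubiniPick f x u (fubiniPick f x v w) - fubiniPick f x v (fubiniPick f x u w)) := by
  ext l
  have hΓ : ∀ u v w : Fin n → ℝ, ∑ i, ∑ j, ∑ k, (∑ m, christoffel (calabiMetric f) l i m x *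
      christoffel (calabiMetric f) m j k x) * u i * v j * w k =
      fubiniPick f x u (fubiniPick f x v w) l := by
    intro u v w
    have h1 := hf.sum_christoffel hx l u (-fubiniPick f x v w)
    rw [← pickBilin_apply f x u, map_neg, pickBilin_apply, Pi.neg_apply, neg_neg] at h1
    rw [← h1]
    refine Finset.sum_congr rfl fun i _ => ?_
    simp only [Pi.neg_apply, ← hf.sum_christoffel hx, Finset.mul_sum, Finset.sum_mul]
    rw [eq_comm, Finset.sum_comm]
    refine Finset.sum_congr rfl fun j _ => ?_
    rw [Finset.sum_comm]
    exact Finset.sum_congr rfl fun k _ => Finset.sum_congr rfl fun m _ => by ring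
  have hswap : ∀ F : Fin n → Fin n → Fin n → ℝ, ∑ i, ∑ j, ∑ k, F j i k * u i * v j * w k =
      ∑ i, ∑ j, ∑ k, F i j k * v i * u j * w k := by
    intro F
    rw [Finset.sum_comm]
    exact Finset.sum_congr rfl fun j _ => Finset.sum_congr rfl fun i _ =>
      Finset.sum_congr rfl fun k _ => by ring
  simp only [Pi.add_apply, Pi.sub_apply, ← hΓ]
  simp only [curvature, riemann, christoffelDeriv]
  rw [← hswap, ← hswap fun i j k => ∑ m, christoffel (calabiMetric f) l i m x *
      christoffel (calabiMetric f) m j k x]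
  simp only [← Finset.sum_add_distrib, ← Finset.sum_sub_distrib]
  refine Finset.sum_congr rfl fun i _ => Finset.sum_congr rfl fun j _ =>
    Finset.sum_congr rfl fun k _ => ?_
  simp only [Finset.sum_sub_distrib]
  ring

/-- The Gauss equation `G(R(u, v)v, u) = |A_u v|² - G(A_u u, A_v v)`. The fourth derivatives of `f`
cancel because they are symmetric. -/
theorem inner_curvature (hf : IsCalabiHypersurface Ω f) (hx : x ∈ Ω) (u v : Fin n → ℝ) :
    innerBilin (calabiMetric f) x (curvature (calabiMetric f) x u v v) u =
      innerBilin (calabiMetric f) x (pickBilin f x u v) (pickBilin f x u v) -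
        innerBilin (calabiMetric f) x (pickBilin f x u u) (pickBilin f x v v) := by
  have hP := hf.isPickAlgebra hx
  rw [hf.curvature_eq_christoffelDeriv hx]
  simp only [map_add, map_sub, LinearMap.add_apply, LinearMap.sub_apply, innerBilin_apply,
    hf.inner_christoffelDeriv hx, hf.third_eq hx]
  simp only [← innerBilin_apply, ← pickBilin_apply]
  rw [hf.fourth_comm hx v u, hP.selfAdjoint u (pickBilin f x v v) u,
    hP.selfAdjoint v (pickBilin f x u v) u, hP.comm v u,
    hP.symm (pickBilin f x v v) (pickBilin f x u u)]
  ring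

theorem sectionalCurvature_eq_iff (hf : IsCalabiHypersurface Ω f) (hx : x ∈ Ω) {κ : ℝ}
    {u v : Fin n → ℝ} (huv : LinearIndependent ℝ ![u, v]) :
    sectionalCurvature (calabiMetric f) x u v = κ ↔
      innerBilin (calabiMetric f) x (pickBilin f x u v) (pickBilin f x u v) -
        innerBilin (calabiMetric f) x (pickBilin f x u u) (pickBilin f x v v) =
      κ * (innerBilin (calabiMetric f) x u u * innerBilin (calabiMetric f) x v v -
        innerBilin (calabiMetric f) x u v ^ 2) := by
  rw [← hf.inner_curvature hx]
  exact div_eq_iff ((hf.isPickAlgebra hx).gram_pos huv).ne'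

end IsCalabiHypersurface

/-! ### Orthonormal frames -/

/-- If `A_{E₀} = μ` on the members of an orthonormal frame other than `E₀`, then `A_{E₀} = μ` on
the orthogonal complement of `E₀`. -/
theorem apply_eq_smul_of_orthonormal {B : (Fin n → ℝ) →ₗ[ℝ] (Fin n → ℝ) →ₗ[ℝ] ℝ}
    {A : (Fin n → ℝ) →ₗ[ℝ] (Fin n → ℝ) →ₗ[ℝ] (Fin n → ℝ)} [NeZero n]
    {E : Fin n → Fin n → ℝ} {μ : ℝ} (hE : ∀ i j, B (E i) (E j) = if i = j then 1 else 0)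
    (hA : ∀ i, i ≠ 0 → A (E 0) (E i) = μ • E i) {X : Fin n → ℝ} (hX : B (E 0) X = 0) :
    A (E 0) X = μ • X := by
  have hli : LinearIndependent ℝ E := by
    rw [Fintype.linearIndependent_iff]
    intro c hc i
    have : B (E i) (∑ j, c j • E j) = 0 := by simp [hc]
    simpa [map_sum, hE] using this
  let b := basisOfLinearIndependentOfCardEqFinrank hli (by simp)
  have hsum := b.sum_repr X
  simp only [b, coe_basisOfLinearIndependentOfCardEqFinrank] at hsum
  set c := (basisOfLinearIndependentOfCardEqFinrank hli (by simp)).repr X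
  have hc0 : c 0 = 0 := by
    rw [← hsum] at hX
    simpa [map_sum, hE] using hX
  rw [← hsum, map_sum, Finset.smul_sum]
  refine Finset.sum_congr rfl fun i _ => ?_
  by_cases hi : i = 0
  · simp [hi, hc0]
  · rw [map_smul, hA i hi, smul_comm]

theorem exists_orthogonal_ne_zero {k : ℕ} (hk : k < n) (φ : Fin k → (Fin n → ℝ) →ₗ[ℝ] ℝ) :
    ∃ w : Fin n → ℝ, w ≠ 0 ∧ ∀ i, φ i w = 0 := by
  have hker := LinearMap.ker_ne_bot_of_finrank_lt (f := LinearMap.pi φ) (by simpa using hk)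
  obtain ⟨w, hw, hw0⟩ := (Submodule.ne_bot_iff _).1 hker
  exact ⟨w, hw0, fun i => congrFun hw i⟩

namespace IsCalabiHypersurface

variable {Ω U : Set (Fin n → ℝ)} {f : (Fin n → ℝ) → ℝ} {x : Fin n → ℝ}

theorem contDiffOn_inner (hf : IsCalabiHypersurface Ω f) (hU : U ⊆ Ω)
    {a b : (Fin n → ℝ) → Fin n → ℝ} (ha : ContDiffOn ℝ ∞ a U) (hb : ContDiffOn ℝ ∞ b U) :
    ContDiffOn ℝ ∞ (fun y => innerBilin (calabiMetric f) y (a y) (b y)) U := by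
  rw [contDiffOn_pi] at ha hb
  simp only [innerBilin_apply, metricInner]
  exact ContDiffOn.sum fun i _ => ContDiffOn.sum fun j _ =>
    (((hf.smooth₂ i j).mono hU).mul (ha i)).mul (hb j)

theorem contDiffOn_third (hf : IsCalabiHypersurface Ω f) (hU : U ⊆ Ω)
    {a : (Fin n → ℝ) → Fin n → ℝ} (ha : ContDiffOn ℝ ∞ a U) :
    ContDiffOn ℝ ∞ (fun y => third f y (a y) (a y) (a y)) U := by
  rw [contDiffOn_pi] at ha
  exact ContDiffOn.sum fun i _ => ContDiffOn.sum fun j _ => ContDiffOn.sum fun k _ =>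
    ((((hf.smooth₃ i j k).mono hU).mul (ha i)).mul (ha j)).mul (ha k)

end IsCalabiHypersurface

/-! ### The Fubini-Pick tensor in normal form -/

/-- `e` is a unit vector field on `U` in terms of which the Fubini-Pick tensor has the normal form
`A_u v = μ (⟨e, u⟩ v + ⟨e, v⟩ u + (⟨u, v⟩ - ⟨e, u⟩⟨e, v⟩) e)`, with a function `μ`. -/
structure IsNormalForm (f : (Fin n → ℝ) → ℝ) (U : Set (Fin n → ℝ))
    (e : (Fin n → ℝ) → Fin n → ℝ) (μ : (Fin n → ℝ) → ℝ) : Prop where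
  unit : ∀ y ∈ U, innerBilin (calabiMetric f) y (e y) (e y) = 1
  apply : ∀ y ∈ U, ∀ u v, pickBilin f y u v =
    μ y • (innerBilin (calabiMetric f) y (e y) u • v + innerBilin (calabiMetric f) y (e y) v • u +
      (innerBilin (calabiMetric f) y u v -
        innerBilin (calabiMetric f) y (e y) u * innerBilin (calabiMetric f) y (e y) v) • e y)

namespace IsNormalForm

variable {Ω U : Set (Fin n → ℝ)} {f : (Fin n → ℝ) → ℝ} {x : Fin n → ℝ}
  {e : (Fin n → ℝ) → Fin n → ℝ} {μ : (Fin n → ℝ) → ℝ}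

/-- `μ` is smooth because `f(e, e, e) = -4 μ`. -/
theorem contDiffOn (hf : IsCalabiHypersurface Ω f) (hU : U ⊆ Ω) (he : ContDiffOn ℝ ∞ e U)
    (hN : IsNormalForm f U e μ) : ContDiffOn ℝ ∞ μ U := by
  refine ((hf.contDiffOn_third hU he).div_const (-4)).congr fun y hy => ?_
  rw [hf.third_eq (hU hy), hN.apply y hy]
  simp only [map_smul, map_add, LinearMap.smul_apply, LinearMap.add_apply, hN.unit y hy,
    smul_eq_mul]
  ring

/-- The derivative along `v` of the identity
`f(w, z, e) = -2 μ (⟨w, z⟩ + ⟨e, w⟩⟨e, z⟩)`, for constant `w`, `z`. -/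
theorem deriv_eq (hf : IsCalabiHypersurface Ω f) (hUo : IsOpen U) (hU : U ⊆ Ω)
    (he : ContDiffOn ℝ ∞ e U) (hN : IsNormalForm f U e μ) (hx : x ∈ U) (v w z : Fin n → ℝ) :
    fourth f x v w z (e x) + third f x w z (fderiv ℝ e x v) =
      -2 * (fderiv ℝ μ x v * (innerBilin (calabiMetric f) x w z +
        innerBilin (calabiMetric f) x (e x) w * innerBilin (calabiMetric f) x (e x) z) +
      μ x * (third f x v w z +
        ((third f x v (e x) w + innerBilin (calabiMetric f) x (fderiv ℝ e x v) w) *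
            innerBilin (calabiMetric f) x (e x) z +
          innerBilin (calabiMetric f) x (e x) w *
            (third f x v (e x) z + innerBilin (calabiMetric f) x (fderiv ℝ e x v) z)))) := by
  have hl : HasDerivAt (fun t : ℝ => x + t • v) v 0 := by
    simpa using ((hasDerivAt_id (0 : ℝ)).smul_const v).const_add x
  have hed : HasDerivAt (fun t : ℝ => e (x + t • v)) (fderiv ℝ e x v) 0 :=
    HasFDerivAt.comp_hasDerivAt_of_eq (0 : ℝ)
      (((he.contDiffAt (hUo.mem_nhds hx)).differentiableAt (by simp)).hasFDerivAt) hl (by simp)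
  have hμd : HasDerivAt (fun t : ℝ => μ (x + t • v)) (fderiv ℝ μ x v) 0 :=
    HasFDerivAt.comp_hasDerivAt_of_eq (0 : ℝ)
      ((((hN.contDiffOn hf hU he).contDiffAt (hUo.mem_nhds hx)).differentiableAt
        (by simp)).hasFDerivAt) hl (by simp)
  have h1 := hf.hasDerivAt_third (hU hx) (v := v) w z hed
  have hwz := hf.hasDerivAt_inner (hU hx) (v := v) (hasDerivAt_const 0 w) (hasDerivAt_const 0 z)
  have hew := hf.hasDerivAt_inner (hU hx) (v := v) hed (hasDerivAt_const 0 w)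
  have hez := hf.hasDerivAt_inner (hU hx) (v := v) hed (hasDerivAt_const 0 z)
  have h2 := (hμd.mul (hwz.add (hew.mul hez))).const_mul (-2)
  have h3 := h1.unique (h2.congr_of_eventuallyEq (by
    filter_upwards [eventually_line_mem hUo hx v] with t ht
    have hP := hf.isPickAlgebra (hU ht)
    rw [hf.third_eq (hU ht), hN.apply _ ht]
    simp only [Pi.mul_apply, Pi.add_apply, ← innerBilin_apply]
    simp only [map_smul, map_add, LinearMap.smul_apply, LinearMap.add_apply, hN.unit _ ht,
      smul_eq_mul, hP.symm z (e (x + t • v)), hP.symm w (e (x + t • v))]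
    ring))
  simp only [Pi.mul_apply, Pi.add_apply, ← innerBilin_apply, zero_smul, add_zero, map_zero,
    LinearMap.zero_apply] at h3
  rw [h3]

theorem deriv_unit (hf : IsCalabiHypersurface Ω f) (hUo : IsOpen U) (hU : U ⊆ Ω)
    (he : ContDiffOn ℝ ∞ e U) (hN : IsNormalForm f U e μ) (hx : x ∈ U) (v : Fin n → ℝ) :
    innerBilin (calabiMetric f) x (fderiv ℝ e x v) (e x) =
      2 * μ x * innerBilin (calabiMetric f) x (e x) v := by
  have hl : HasDerivAt (fun t : ℝ => x + t • v) v 0 := by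
    simpa using ((hasDerivAt_id (0 : ℝ)).smul_const v).const_add x
  have hed : HasDerivAt (fun t : ℝ => e (x + t • v)) (fderiv ℝ e x v) 0 :=
    HasFDerivAt.comp_hasDerivAt_of_eq (0 : ℝ)
      (((he.contDiffAt (hUo.mem_nhds hx)).differentiableAt (by simp)).hasFDerivAt) hl (by simp)
  have h1 := hf.hasDerivAt_inner (hU hx) (v := v) hed hed
  have h2 := h1.unique ((hasDerivAt_const (0 : ℝ) (1 : ℝ)).congr_of_eventuallyEq (by
    filter_upwards [eventually_line_mem hUo hx v] with t ht
    exact hN.unit _ ht))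
  have hP := hf.isPickAlgebra (hU hx)
  simp only [← innerBilin_apply, zero_smul, add_zero, hf.third_eq (hU hx), hN.apply x hx] at h2
  simp only [map_smul, map_add, LinearMap.smul_apply, LinearMap.add_apply, hN.unit _ hx,
      smul_eq_mul, hP.symm v (e x), hP.symm (e x) (fderiv ℝ e x v)] at h2
  linarith

/-- The Codazzi equation, in the form of the symmetry of `fourth`, forces `μ` to be locally
constant. -/
theorem fderiv_eq_zero (hf : IsCalabiHypersurface Ω f) (hn : 2 ≤ n) (hUo : IsOpen U)
    (hU : U ⊆ Ω) (he : ContDiffOn ℝ ∞ e U)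
    (hN : IsNormalForm f U e μ) (hx : x ∈ U) : fderiv ℝ μ x = 0 := by
  have hP := hf.isPickAlgebra (hU hx)
  have h1 := hN.unit x hx
  have hA := hN.apply x hx
  have hC := hf.third_eq (hU hx)
  have hD := hN.deriv_eq hf hUo hU he hx
  have hS := hf.fourth_comm (hU hx)
  have hu := hN.deriv_unit hf hUo hU he hx
  -- For `X ⊥ e` the directions `(X, e)` with `z = e` give `dμ(X) = 0`, and with `z = X` they
  -- give `dμ(e) |X|² = 0`; the unknown products with the derivatives of `e` cancel.
  have codazzi : ∀ X, innerBilin (calabiMetric f) x (e x) X = 0 →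
      fderiv ℝ μ x X = 0 ∧
        fderiv ℝ μ x (e x) * innerBilin (calabiMetric f) x X X = 0 := by
    intro X hX
    have a1 := hD X (e x) (e x)
    have a2 := hD (e x) X (e x)
    have b1 := hD (e x) X X
    have b2 := hD X (e x) X
    have u1 := hu X
    have u2 := hu (e x)
    have s1 := hP.symm (e x) (fderiv ℝ e x (e x))
    have s2 := hP.symm (e x) (fderiv ℝ e x X)
    have s3 := hP.symm X (fderiv ℝ e x (e x))
    have s4 := hP.symm X (fderiv ℝ e x X)
    rw [hS X] at a1 b2
    simp only [hC, hA, map_smul, map_add, LinearMap.smul_apply, LinearMap.add_apply,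
      smul_eq_mul, hP.symm X (e x), hX, h1, s1, s2, s3, s4, u1, u2] at a1 a2 b1 b2
    constructor
    · linarith
    · linarith
  obtain ⟨X, hX0, hX⟩ := exists_orthogonal_ne_zero (k := 1) (by omega)
    fun _ => innerBilin (calabiMetric f) x (e x)
  have he0 : fderiv ℝ μ x (e x) = 0 := by
    have := (codazzi X (hX 0)).2
    exact (mul_eq_zero.1 this).resolve_right (hP.pos X hX0).ne'
  ext v
  have := (codazzi (v - innerBilin (calabiMetric f) x (e x) v • e x) (by simp [h1])).1
  rw [map_sub, map_smul, he0] at this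
  simpa using this

end IsNormalForm

/-! ### Constancy of `λ₁` and of the curvature -/

namespace IsCalabiHypersurface

variable {Ω U : Set (Fin n → ℝ)} {f : (Fin n → ℝ) → ℝ} {x : Fin n → ℝ}

/-- The pointwise normal form holds along every special Ejiri frame, so that `lam` is locally, hence
globally, constant, and the Gauss equation gives the curvature. -/
theorem constant_of_hasSpecialEjiriFrame [NeZero n] (hf : IsCalabiHypersurface Ω f) (hn : 2 ≤ n)
    {lam : (Fin n → ℝ) → ℝ} (hE : HasSpecialEjiriFrame f Ω lam) :
    ∃ c : ℝ, 0 < c ∧ (∀ x ∈ Ω, lam x = c) ∧ (∀ x ∈ Ω, theta f x = c) ∧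
      HasConstantSectionalCurvature (calabiMetric f) Ω (-(c / 2) ^ 2) := by
  have hlocal : ∀ x ∈ Ω, DifferentiableAt ℝ lam x ∧ fderiv ℝ lam x = 0 ∧ 0 < lam x ∧
      theta f x = lam x ∧ ∃ e, innerBilin (calabiMetric f) x e e = 1 ∧
        ∀ u v, pickBilin f x u v =
          (lam x / 2) • (innerBilin (calabiMetric f) x e u • v +
            innerBilin (calabiMetric f) x e v • u + (innerBilin (calabiMetric f) x u v -
            innerBilin (calabiMetric f) x e u * innerBilin (calabiMetric f) x e v) • e) := by
    intro x hx
    obtain ⟨U, hUo, hxU, hU, E, hEj, hEU⟩ := hE x hx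
    have hunit : ∀ y ∈ U, innerBilin (calabiMetric f) y (E 0 y) (E 0 y) = 1 := fun y hy => 
      (hEj.orthonormal y hy 0 0).trans (if_pos rfl)
    have hval : ∀ y ∈ U, pickForm f y (E 0 y) = lam y := fun y hy => by
      have := hunit y hy
      rw [pickForm, (hEU y hy).2.1, ← innerBilin_apply, map_smul, LinearMap.smul_apply, this]
      simp
    have hN : IsNormalForm f U (E 0) (fun y => lam y / 2) := by
      refine ⟨hunit, fun y hy u v => ?_⟩
      obtain ⟨hpos, hee, hei⟩ := hEU y hy
      refine (hf.isPickAlgebra (hU hy)).apply_eq hpos.le (fun u hu => ?_) (hunit y hy) ?_ ?_ u v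
      · have := hEj.isMax y hy u hu
        rw [hval y hy] at this
        rw [mul_div_cancel₀ _ two_ne_zero]
        exact this
      · rw [mul_div_cancel₀ _ two_ne_zero]
        exact hee
      · exact fun X hX => apply_eq_smul_of_orthonormal (E := fun i => E i y)
          (hEj.orthonormal y hy) hei hX
    have hsm := hN.contDiffOn hf hU (hEj.smooth 0)
    have hd : HasFDerivAt (fun y => lam y / 2) (0 : (Fin n → ℝ) →L[ℝ] ℝ) x := by
      rw [← hN.fderiv_eq_zero hf hn hUo hU (hEj.smooth 0) hxU]
      exact ((hsm.contDiffAt (hUo.mem_nhds hxU)).differentiableAt (by simp)).hasFDerivAt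
    have hd' : HasFDerivAt lam (0 : (Fin n → ℝ) →L[ℝ] ℝ) x := by
      have := hd.const_mul 2
      simpa [mul_div_cancel₀] using this
    refine ⟨hd'.differentiableAt, hd'.fderiv, by linarith [(hEU x hxU).1], ?_, E 0 x,
      hunit x hxU, hN.apply x hxU⟩
    refine IsGreatest.csSup_eq ⟨⟨E 0 x, hunit x hxU, (hval x hxU).symm⟩, ?_⟩
    rintro r ⟨u, hu, rfl⟩
    exact hval x hxU ▸ hEj.isMax x hxU u hu
  obtain ⟨x₀, hx₀⟩ := hf.isConnected.nonempty
  have hconst : ∀ x ∈ Ω, lam x = lam x₀ := fun x hx =>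
    hf.isOpen.is_const_of_fderiv_eq_zero hf.isConnected.isPreconnected
      (fun y hy => (hlocal y hy).1.differentiableWithinAt) (fun y hy => (hlocal y hy).2.1) hx hx₀
  refine ⟨lam x₀, (hlocal x₀ hx₀).2.2.1, hconst, fun x hx => ?_, fun x hx u v huv => ?_⟩
  · rw [(hlocal x hx).2.2.2.1, hconst x hx]
  · obtain ⟨e, he, hA⟩ := (hlocal x hx).2.2.2.2
    rw [hconst x hx] at hA
    rw [hf.sectionalCurvature_eq_iff hx huv]
    exact (hf.isPickAlgebra hx).curvature_eq he hA u v

/-! ### Construction of the Ejiri frame -/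

/-- A positive definite metric has a compact unit sphere, so `θ` is attained. -/
theorem exists_max [NeZero n] (hf : IsCalabiHypersurface Ω f) (hx : x ∈ Ω) :
    ∃ e, metricInner (calabiMetric f) x e e = 1 ∧ pickForm f x e = theta f x ∧
      ∀ u, metricInner (calabiMetric f) x u u = 1 → pickForm f x u ≤ theta f x := by
  have hP := hf.isPickAlgebra hx
  set B := innerBilin (calabiMetric f) x with hB
  have hcB : Continuous fun u => metricInner (calabiMetric f) x u u := by
    unfold metricInner
    fun_prop
  have hcF : Continuous fun u => pickForm f x u := by
    unfold pickForm metricInner fubiniPick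
    fun_prop
  set S := {u : Fin n → ℝ | metricInner (calabiMetric f) x u u = 1} with hS
  have hne1 : (Pi.single 0 1 : Fin n → ℝ) ≠ 0 := by simp
  have hSne : S.Nonempty := by
    have hpos := hP.pos _ hne1
    set q := B (Pi.single 0 1) (Pi.single 0 1) with hq
    refine ⟨(√q)⁻¹ • Pi.single 0 1, ?_⟩
    change B _ _ = 1
    simp only [map_smul, LinearMap.smul_apply, smul_eq_mul, ← hq]
    rw [← mul_assoc, ← mul_inv, Real.mul_self_sqrt hpos.le, inv_mul_cancel₀ hpos.ne']
  obtain ⟨u₀, hu₀, hmin⟩ := (isCompact_sphere (0 : Fin n → ℝ) 1).exists_isMinOn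
    (NormedSpace.sphere_nonempty.2 zero_le_one) hcB.continuousOn
  have hm : 0 < B u₀ u₀ := hP.pos _ (by
    rintro rfl
    simp at hu₀)
  have hbdd : Bornology.IsBounded S := by
    rw [isBounded_iff_forall_norm_le]
    refine ⟨1 + (B u₀ u₀)⁻¹, fun u hu => ?_⟩
    have hu1 : B u u = 1 := hu
    have hu0 : u ≠ 0 := by
      rintro rfl
      simp at hu1
    have hn0 : 0 < ‖u‖ := norm_pos_iff.2 hu0
    have h1 : B u₀ u₀ ≤ B (‖u‖⁻¹ • u) (‖u‖⁻¹ • u) := hmin (by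
      simp [norm_smul, hn0.ne'])
    simp only [map_smul, LinearMap.smul_apply, smul_eq_mul, hu1, mul_one] at h1
    have h2 : ‖u‖ ^ 2 ≤ (B u₀ u₀)⁻¹ := by
      rw [← mul_inv, ← sq] at h1
      exact le_inv_of_le_inv₀ hm h1
    nlinarith [sq_nonneg (‖u‖ - 1)]
  have hcomp : IsCompact S :=
    Metric.isCompact_of_isClosed_isBounded (isClosed_eq hcB continuous_const) hbdd
  obtain ⟨e, he, hmax⟩ := hcomp.exists_isMaxOn hSne hcF.continuousOn
  have hθ : theta f x = pickForm f x e := by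
    refine IsGreatest.csSup_eq ⟨⟨e, he, rfl⟩, ?_⟩
    rintro r ⟨u, hu, rfl⟩
    exact hmax hu
  exact ⟨e, he, hθ.symm, fun u hu => hθ ▸ hmax hu⟩

/-- The trace of a Fubini-Pick tensor in normal form is `(n + 1) μ e`. This is what makes the
maximizing vector field `e` smooth. -/
theorem trace_fubiniPick (hf : IsCalabiHypersurface Ω f) (hx : x ∈ Ω) {e : Fin n → ℝ} {μ : ℝ}
    (he : innerBilin (calabiMetric f) x e e = 1)
    (hA : ∀ u v, pickBilin f x u v =
      μ • (innerBilin (calabiMetric f) x e u • v + innerBilin (calabiMetric f) x e v • u +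
        (innerBilin (calabiMetric f) x u v -
          innerBilin (calabiMetric f) x e u * innerBilin (calabiMetric f) x e v) • e)) (k : Fin n) :
    ∑ i, ∑ j, (calabiMetric f x)⁻¹ i j *
      (-(1 / 2) * ∑ l, (calabiMetric f x)⁻¹ k l * pd i (pd j (pd l f)) x) =
      (n + 1) * μ * e k := by
  set g := calabiMetric f x with hg
  set η : Fin n → ℝ := fun i => ∑ a, g a i * e a with hη
  have hsymm : ∀ i j, g i j = g j i := hf.metric_symm hx
  have hinv : ∀ i k, ∑ j, g⁻¹ i j * g j k = if i = k then 1 else 0 := by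
    intro i k
    have := congrFun (congrFun (Matrix.nonsing_inv_mul _ (hf.isUnit_det hx)) i) k
    rwa [Matrix.mul_apply, Matrix.one_apply] at this
  have hinvs : ∀ i j, g⁻¹ i j = g⁻¹ j i := by
    intro i j
    have hgT : g.transpose = g := by ext a b; exact hsymm b a
    have := congrFun (congrFun (Matrix.transpose_nonsing_inv g) j) i
    rwa [hgT] at this
  have hB : ∀ i, innerBilin (calabiMetric f) x e (Pi.single i 1) = η i := by
    intro i
    simp [innerBilin_apply, metricInner, hη, hg, Pi.single_apply]
  have hBij : ∀ i j, innerBilin (calabiMetric f) x (Pi.single i 1) (Pi.single j 1) = g i j := by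
    intro i j
    simp [innerBilin_apply, metricInner, hg, Pi.single_apply]
  have hraise : ∀ i, ∑ j, g⁻¹ i j * η j = e i := by
    intro i
    simp only [hη, Finset.mul_sum]
    rw [Finset.sum_comm]
    have : ∀ a, ∑ j, g⁻¹ i j * (g a j * e a) = (if i = a then 1 else 0) * e a := by
      intro a
      rw [← hinv, Finset.sum_mul]
      exact Finset.sum_congr rfl fun j _ => by rw [hsymm a j]; ring
    simp [this]
  have hηe : ∑ i, η i * e i = 1 := by
    rw [← he, innerBilin_apply, metricInner, Finset.sum_comm]
    simp only [hη, Finset.sum_mul, hg]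
  have hentry : ∀ i j, (-(1 / 2) * ∑ l, g⁻¹ k l * pd i (pd j (pd l f)) x) =
      μ * (η i * (if k = j then 1 else 0) + η j * (if k = i then 1 else 0) +
        (g i j - η i * η j) * e k) := by
    intro i j
    have := congrFun (hA (Pi.single i 1) (Pi.single j 1)) k
    rw [hB, hB, hBij, pickBilin_apply] at this
    simpa [fubiniPick, Pi.single_apply, hg] using this
  have h1 : ∑ i, ∑ j, g⁻¹ i j * (η i * (if k = j then 1 else 0)) = e k := by
    rw [← hraise k]
    exact Finset.sum_congr rfl fun i _ => by simp [hinvs i k]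
  have h2 : ∑ i, ∑ j, g⁻¹ i j * (η j * (if k = i then 1 else 0)) = e k := by
    rw [Finset.sum_comm, ← hraise k]
    exact Finset.sum_congr rfl fun i _ => by simp
  have h3 : ∑ i, ∑ j, g⁻¹ i j * g i j = n := by
    have : ∀ i, ∑ j, g⁻¹ i j * g i j = 1 := by
      intro i
      have := hinv i i
      rw [if_pos rfl] at this
      rw [← this]
      exact Finset.sum_congr rfl fun j _ => by rw [hsymm i j]
    simp [this]
  have h4 : ∑ i, ∑ j, g⁻¹ i j * (η i * η j) = 1 := by
    rw [← hηe]
    refine Finset.sum_congr rfl fun i _ => ?_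
    rw [← hraise i, Finset.mul_sum]
    exact Finset.sum_congr rfl fun j _ => by ring
  simp only [hentry]
  calc ∑ i, ∑ j, g⁻¹ i j * (μ * (η i * (if k = j then 1 else 0) +
        η j * (if k = i then 1 else 0) + (g i j - η i * η j) * e k))
      = μ * (∑ i, ∑ j, g⁻¹ i j * (η i * (if k = j then 1 else 0)) +
        ∑ i, ∑ j, g⁻¹ i j * (η j * (if k = i then 1 else 0)) +
        ((∑ i, ∑ j, g⁻¹ i j * g i j) - ∑ i, ∑ j, g⁻¹ i j * (η i * η j)) * e k) := by
        simp only [← Finset.sum_add_distrib, ← Finset.sum_sub_distrib, Finset.mul_sum,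
          Finset.sum_mul]
        exact Finset.sum_congr rfl fun i _ => Finset.sum_congr rfl fun j _ => by ring
    _ = (n + 1) * μ * e k := by
        rw [h1, h2, h3, h4]
        ring

/-- Gram-Schmidt: a smooth unit vector field is, near every point, the first member of a smooth
orthonormal family of any length `k + 1 ≤ n`. The family is indexed by `ℕ`, and its members
past `k` are irrelevant. -/
theorem exists_orthonormal_family (hf : IsCalabiHypersurface Ω f)
    {e : (Fin n → ℝ) → Fin n → ℝ} (he : ContDiffOn ℝ ∞ e Ω)
    (h1 : ∀ y ∈ Ω, innerBilin (calabiMetric f) y (e y) (e y) = 1) {p : Fin n → ℝ} (hp : p ∈ Ω)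
    (k : ℕ) (hk : k < n) :
    ∃ U : Set (Fin n → ℝ), IsOpen U ∧ p ∈ U ∧ U ⊆ Ω ∧
      ∃ E : ℕ → (Fin n → ℝ) → (Fin n → ℝ), E 0 = e ∧ (∀ i ≤ k, ContDiffOn ℝ ∞ (E i) U) ∧
        ∀ y ∈ U, ∀ i ≤ k, ∀ j ≤ k,
          innerBilin (calabiMetric f) y (E i y) (E j y) = if i = j then 1 else 0 := by
  induction k with
  | zero =>
    refine ⟨Ω, hf.isOpen, hp, subset_rfl, fun _ => e, rfl, fun _ _ => he, fun y hy i hi j hj => ?_⟩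
    rw [h1 y hy, if_pos (by omega)]
  | succ k ih =>
    obtain ⟨U, hUo, hpU, hU, E, hE0, hEs, hEo⟩ := ih (by omega)
    obtain ⟨w, hw0, hw⟩ := exists_orthogonal_ne_zero (k := k + 1) hk
      fun i => innerBilin (calabiMetric f) p (E i p)
    -- The projection of the constant field `w` away from the span of the family built so far.
    set W : (Fin n → ℝ) → Fin n → ℝ := fun y =>
      w - ∑ i ∈ Finset.range (k + 1), innerBilin (calabiMetric f) y (E i y) w • E i y with hW
    have hWs : ContDiffOn ℝ ∞ W U := by
      refine contDiffOn_const.sub (ContDiffOn.sum fun i hi => ?_)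
      have hi' : i ≤ k := by simpa [Nat.lt_succ_iff] using hi
      exact (hf.contDiffOn_inner hU (hEs i hi') contDiffOn_const).smul (hEs i hi')
    have hWp : W p = w := by
      rw [hW]
      simp only [sub_eq_self]
      refine Finset.sum_eq_zero fun i hi => ?_
      have := hw ⟨i, Finset.mem_range.1 hi⟩
      simp only at this
      rw [this, zero_smul]
    have hWE : ∀ y ∈ U, ∀ j ≤ k, innerBilin (calabiMetric f) y (E j y) (W y) = 0 := by
      intro y hy j hj
      simp only [hW, map_sub, map_sum, map_smul, smul_eq_mul]
      rw [Finset.sum_congr rfl (g := fun i => if j = i then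
        innerBilin (calabiMetric f) y (E i y) w else 0)]
      · simp [hj]
      · intro i hi
        rw [hEo y hy j hj i (by simpa [Nat.lt_succ_iff] using hi)]
        simp
    set q : (Fin n → ℝ) → ℝ := fun y => innerBilin (calabiMetric f) y (W y) (W y) with hq
    have hqs : ContDiffOn ℝ ∞ q U := hf.contDiffOn_inner hU hWs hWs
    refine ⟨U ∩ q ⁻¹' Set.Ioi 0, hqs.continuousOn.isOpen_inter_preimage hUo isOpen_Ioi,
      ⟨hpU, ?_⟩, fun y hy => hU hy.1,
      fun i => if i = k + 1 then fun y => (√(q y))⁻¹ • W y else E i, ?_, ?_, ?_⟩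
    · change 0 < q p
      simp only [hq, hWp]
      exact (hf.isPickAlgebra hp).pos w hw0
    · simp [hE0]
    · intro i hi
      by_cases hik : i = k + 1
      · simp only [hik, if_true]
        refine ContDiffOn.smul (ContDiffOn.inv ?_ fun y hy => (Real.sqrt_pos.2 hy.2).ne')
          (hWs.mono Set.inter_subset_left)
        exact (hqs.mono Set.inter_subset_left).sqrt fun y hy => ne_of_gt hy.2
      · simp only [hik, if_false]
        exact (hEs i (by omega)).mono Set.inter_subset_left
    · intro y hy i hi j hj
      have hqy : 0 < q y := hy.2
      by_cases hik : i = k + 1 <;> by_cases hjk : j = k + 1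
      · simp only [hik, hjk, if_true, map_smul, LinearMap.smul_apply, smul_eq_mul]
        change (√(q y))⁻¹ * ((√(q y))⁻¹ * q y) = 1
        rw [← mul_assoc, ← mul_inv, Real.mul_self_sqrt hqy.le, inv_mul_cancel₀ hqy.ne']
      · simp only [hik, hjk, if_true, if_false, map_smul, LinearMap.smul_apply, smul_eq_mul]
        rw [(hf.isPickAlgebra (hU hy.1)).symm, hWE y hy.1 j (by omega), mul_zero,
          if_neg (Ne.symm hjk)]
      · simp only [hik, hjk, if_true, if_false, map_smul, smul_eq_mul]
        rw [hWE y hy.1 i (by omega), mul_zero]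
      · simp only [hik, hjk, if_false]
        exact hEo y hy.1 i (by omega) j (by omega)

/-- The maximizing unit vectors at the points of `Ω` form a smooth vector field, because they are
the normalized traces of the Fubini-Pick tensor; it is completed to a frame by Gram-Schmidt. -/
theorem hasSpecialEjiriFrame_of_constant [NeZero n] (hf : IsCalabiHypersurface Ω f)
    {lam : (Fin n → ℝ) → ℝ} {c : ℝ} (hc : 0 < c) (hlam : ∀ x ∈ Ω, lam x = c)
    (hθ : ∀ x ∈ Ω, theta f x = c)
    (hK : HasConstantSectionalCurvature (calabiMetric f) Ω (-(c / 2) ^ 2)) :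
    HasSpecialEjiriFrame f Ω lam := by
  have hmax : ∀ x, ∃ e, x ∈ Ω → innerBilin (calabiMetric f) x e e = 1 ∧ pickForm f x e = c ∧
      ∀ u, metricInner (calabiMetric f) x u u = 1 → pickForm f x u ≤ c := by
    intro x
    by_cases hx : x ∈ Ω
    · obtain ⟨e, he⟩ := hf.exists_max hx
      exact ⟨e, fun _ => hθ x hx ▸ he⟩
    · exact ⟨0, fun h => absurd h hx⟩
  choose e he using hmax
  have hc2 : 2 * (c / 2) = c := by ring
  have hee : ∀ x ∈ Ω, pickBilin f x (e x) (e x) = c • e x := fun x hx =>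
    (hf.isPickAlgebra hx).apply_self_of_max hc.le (he x hx).2.2 (he x hx).1 (he x hx).2.1
  have heX : ∀ x ∈ Ω, ∀ X, innerBilin (calabiMetric f) x (e x) X = 0 →
      pickBilin f x (e x) X = (c / 2) • X := fun x hx X hX =>
    (hf.isPickAlgebra hx).apply_of_curvature (he x hx).1 (by rw [hc2]; exact hee x hx)
      (fun u v huv => (hf.sectionalCurvature_eq_iff hx huv).1 (hK x hx u v huv)) hX
  have hA := fun x hx => (hf.isPickAlgebra hx).apply_eq (by positivity)
    (by rw [hc2]; exact (he x hx).2.2) (he x hx).1 (by rw [hc2]; exact hee x hx) (heX x hx)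
  have hes : ContDiffOn ℝ ∞ e Ω := by
    rw [contDiffOn_pi]
    intro k
    have hs : ContDiffOn ℝ ∞ (fun x => (∑ i, ∑ j, (calabiMetric f x)⁻¹ i j *
        (-(1 / 2) * ∑ l, (calabiMetric f x)⁻¹ k l * pd i (pd j (pd l f)) x)) /
          ((n + 1) * (c / 2))) Ω := by
      refine ContDiffOn.div_const (ContDiffOn.sum fun i _ => ContDiffOn.sum fun j _ => ?_) _
      exact (hf.contDiffOn_inv i j).mul (contDiffOn_const.mul
        (ContDiffOn.sum fun l _ => (hf.contDiffOn_inv k l).mul (hf.smooth₃ i j l)))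
    refine hs.congr fun x hx => ?_
    rw [hf.trace_fubiniPick hx (he x hx).1 (hA x hx), eq_div_iff (by positivity)]
    ring
  intro p hp
  have hn0 : n ≠ 0 := NeZero.ne n
  obtain ⟨U, hUo, hpU, hU, E, hE0, hEs, hEo⟩ :=
    hf.exists_orthonormal_family hes (fun y hy => (he y hy).1) hp (n - 1) (by omega)
  have hle : ∀ i : Fin n, (i : ℕ) ≤ n - 1 := fun i => by omega
  have hE0' : E ((0 : Fin n) : ℕ) = e := by simpa using hE0
  have horth : ∀ x ∈ U, ∀ i j : Fin n, innerBilin (calabiMetric f) x (E i x) (E j x) =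
      if i = j then 1 else 0 := fun x hx i j => by
    rw [hEo x hx i (hle i) j (hle j)]
    simp [Fin.ext_iff]
  refine ⟨U, hUo, hpU, hU, fun i => E i, ⟨fun i => hEs i (hle i), horth, fun x hx u hu => ?_⟩,
    fun x hx => ?_⟩
  · simp only [hE0']
    exact (he x (hU hx)).2.1 ▸ (he x (hU hx)).2.2 u hu
  · simp only [hE0', hlam x (hU hx)]
    refine ⟨by positivity, hee x (hU hx), fun i hi => heX x (hU hx) _ ?_⟩
    rw [← hE0', horth x hx, if_neg (Ne.symm hi)]

end IsCalabiHypersurface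

end CalabiGeometry

end

theorem proposition3p2 (n : ℕ) [NeZero n] (hn : 2 ≤ n)
    (Ω : Set (Fin n → ℝ)) (f : (Fin n → ℝ) → ℝ)
    (hf : CalabiGeometry.IsCalabiHypersurface Ω f)
    (lam : (Fin n → ℝ) → ℝ) :
    CalabiGeometry.HasSpecialEjiriFrame f Ω lam ↔
      ∃ c : ℝ, 0 < c ∧ (∀ x ∈ Ω, lam x = c) ∧
        (∀ x ∈ Ω, CalabiGeometry.theta f x = c) ∧
        CalabiGeometry.HasConstantSectionalCurvature
          (CalabiGeometry.calabiMetric f) Ω (-(c / 2) ^ 2) := by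
  constructor
  · exact hf.constant_of_hasSpecialEjiriFrame hn
  · rintro ⟨c, hc, hlam, hθ, hK⟩
    exact hf.hasSpecialEjiriFrame_of_constant hc hlam hθ hK
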